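/- Semigroup presentations. For a non-empty alphabet $A$ let $A^+$ and $A^*$ be the free semigroup and the free monoid on $A$. A semigroup presentation $\langle A\mid R\rangle$ consists of $A$ and a set $R\subseteq A^+\times A^+$ of rules $r=(r_{+1},r_{-1})$; it defines the semigroup $S$ if $S$ is isomorphic to the quotient of $A^+$ by the congruence generated by $R$. It is finite if $A$ and $R$ are finite. Its derivation graph $\Gamma$ has vertex set $A^+$ and edges $\mathbb E=(w_1,r,\epsilon,w_2)$ with $w_1,w_2\in A^*$, $r\in R$, $\epsilon\in\{+1,-1\}$, where $\mathbb E$ goes from $\iota\mathbb E=w_1r_{\epsilon}w_2$ to $\tau\mathbb E=w_1r_{-\epsilon}w_2$ and has inverse $\mathbb E^{-1}=(w_1,r,-\epsilon,w_2)$. Paths $\mathbb P$ (including the empty path $1_w$ at each vertex $w$), their initial and terminal vertices $\iota\mathbb P,\tau\mathbb P$, their compositions and their inverses $\mathbb P^{-1}$ are defined as usual. For $x,y\in A^*$ put $x\cdot\mathbb E\cdot y=(xw_1,r,\epsilon,w_2y)$, and extend this edge by edge to paths. Two paths are parallel, $\mathbb P\parallel\mathbb Q$, if $\iota\mathbb P=\iota\mathbb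 Q$ and $\tau\mathbb P=\tau\mathbb Q$. A homotopy relation is an equivalence relation $\sim$ on the set of paths of $\Gamma$, contained in $\parallel$, such that: (H1) $(\mathbb E_1\cdot\iota\mathbb E_2)(\tau\mathbb E_1\cdot\mathbb E_2)\sim(\iota\mathbb E_1\cdot\mathbb E_2)(\mathbb E_1\cdot\tau\mathbb E_2)$ for all edges $\mathbb E_1,\mathbb E_2$; (H2) $\mathbb P\sim\mathbb Q$ implies $x\cdot\mathbb P\cdot y\sim x\cdot\mathbb Q\cdot y$ for all $x,y\in A^*$; (H3) $\mathbb P\sim\mathbb Q$ implies $\mathbb T\mathbb P\mathbb U\sim\mathbb T\mathbb Q\mathbb U$ for all paths $\mathbb T,\mathbb U$ with $\tau\mathbb T=\iota\mathbb P=\iota\mathbb Q$ and $\iota\mathbb U=\tau\mathbb P=\tau\mathbb Q$; (H4) $\mathbb P\mathbb P^{-1}\sim 1_{\iota\mathbb P}$ for every path $\mathbb P$. A homotopy base of $\langle A\mid R\rangle$ is a set $C$ of pairs of parallel paths such that the smallest homotopy relation containing $C$ is $\parallel$. A semigroup (in particular, a monoid) has finite derivation type if some finite semigroup presentation defining it has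 a finite homotopy base. Subgroups. A subgroup $G$ of a semigroup $S$ is a subsemigroup that is a group under the multiplication of $S$; its identity need not be an identity of $S$. A right coset of $G$ in $S$ is a set $Gs$ with $s\in S$ for which there is $s'\in S$ with $Gss'=G$. The subgroup $G$ has finite translational index in $S$ if it has only finitely many right cosets. **Theorem.** Let $S$ be a semigroup (in particular, $S$ may be a monoid) and let $G$ be a subgroup of $S$. If $S$ has finite derivation type and $G$ has finite translational index in $S$, then $G$ has finite derivation type. -/

import Mathlib

universe u v

namespace FDT

/-! ### Words

The free semigroup `A⁺` is Mathlib's `FreeSemigroup A`; elements of the free monoid `A^*` are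
written as lists of letters. -/

/-- The letters of a non-empty word. -/
def letters {A : Type u} (w : FreeSemigroup A) : List A := w.head :: w.tail

/-- The word `x w y` of `A⁺`, for `x, y ∈ A^*` and `w ∈ A⁺`. -/
def sandwich {A : Type u} : List A → FreeSemigroup A → List A → FreeSemigroup A
  | [], w, y => ⟨w.head, w.tail ++ y⟩
  | a :: x, w, y => ⟨a, x ++ letters w ++ y⟩

theorem letters_injective {A : Type u} : Function.Injective (letters (A := A)) := by
  intro v w h
  cases v; cases w
  simp only [letters, List.cons.injEq] at h
  simp [h.1, h.2]

theorem letters_mul {A : Type u} (v w : FreeSemigroup A) :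
    letters (v * w) = letters v ++ letters w := rfl

theorem letters_sandwich {A : Type u} (x : List A) (w : FreeSemigroup A) (y : List A) :
    letters (sandwich x w y) = x ++ letters w ++ y := by
  cases x <;> simp [letters, sandwich]

theorem sandwich_sandwich {A : Type u} (x x' : List A) (w : FreeSemigroup A) (y y' : List A) :
    sandwich x' (sandwich x w y) y' = sandwich (x' ++ x) w (y ++ y') :=
  letters_injective (by simp [letters_sandwich])

theorem sandwich_mul {A : Type u} (x : List A) (w v : FreeSemigroup A) (y : List A) :
    sandwich x w y * v = sandwich x w (y ++ letters v) :=
  letters_injective (by simp [letters_mul, letters_sandwich])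

theorem mul_sandwich {A : Type u} (x : List A) (v w : FreeSemigroup A) (y : List A) :
    v * sandwich x w y = sandwich (letters v ++ x) w y :=
  letters_injective (by simp [letters_mul, letters_sandwich])

/-! ### Presentations -/

/-- A rewriting system over `A`: a set of pairs of non-empty words.  Together with `A` it is the
semigroup presentation `⟨A | R⟩`. -/
abbrev Rules (A : Type u) : Type u := Set (FreeSemigroup A × FreeSemigroup A)

/-- The presentation `⟨A | R⟩` defines the semigroup `S`: the quotient of `A⁺` by the congruence
generated by `R` is isomorphic to `S`. -/
def Defines {A : Type u} (R : Rules A) (S : Type v) [Semigroup S] : Prop :=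
  Nonempty ((conGen fun p q : FreeSemigroup A => (p, q) ∈ R).Quotient ≃* S)

/-! ### The derivation graph: vertices are the elements of `FreeSemigroup A` -/

/-- The edges `(w₁, r, ε, w₂)` of the derivation graph of `⟨A | R⟩`; the sign `ε` is `true` for
`+1` and `false` for `-1`. -/
@[ext] structure Edge {A : Type u} (R : Rules A) : Type u where
  left : List A
  rule : R
  sign : Bool
  right : List A

/-- The two sides of a rule `r = (r₊₁, r₋₁)`. -/
def side {A : Type u} {R : Rules A} (r : R) : Bool → FreeSemigroup A
  | true => r.1.1
  | false => r.1.2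

namespace Edge

variable {A : Type u} {R : Rules A}

/-- Initial vertex `w₁ r_ε w₂`. -/
def init (E : Edge R) : FreeSemigroup A := sandwich E.left (side E.rule E.sign) E.right

/-- Terminal vertex `w₁ r_{-ε} w₂`. -/
def term (E : Edge R) : FreeSemigroup A := sandwich E.left (side E.rule !E.sign) E.right

/-- The inverse edge `(w₁, r, -ε, w₂)`. -/
def inv (E : Edge R) : Edge R := ⟨E.left, E.rule, !E.sign, E.right⟩

/-- The two-sided action `x · E · y = (x w₁, r, ε, w₂ y)` of `A^*`. -/
def act (x : List A) (E : Edge R) (y : List A) : Edge R :=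
  ⟨x ++ E.left, E.rule, E.sign, E.right ++ y⟩

theorem init_inv (E : Edge R) : E.inv.init = E.term := rfl

theorem term_inv (E : Edge R) : E.inv.term = E.init := by
  simp [inv, term, init]

theorem init_act (x : List A) (E : Edge R) (y : List A) :
    (E.act x y).init = sandwich x E.init y := by
  simp [act, init, sandwich_sandwich]

theorem term_act (x : List A) (E : Edge R) (y : List A) :
    (E.act x y).term = sandwich x E.term y := by
  simp [act, term, sandwich_sandwich]

end Edge

/-- Starting at `w`, consecutive edges of the list fit together. -/
def IsWalk {A : Type u} {R : Rules A} : FreeSemigroup A → List (Edge R) → Prop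
  | _, [] => True
  | w, E :: l => E.init = w ∧ IsWalk E.term l

/-- The last vertex reached when following a list of edges from `w`. -/
def endpoint {A : Type u} {R : Rules A} : FreeSemigroup A → List (Edge R) → FreeSemigroup A
  | w, [] => w
  | _, E :: l => endpoint E.term l

theorem endpoint_append {A : Type u} {R : Rules A} (w : FreeSemigroup A) (l m : List (Edge R)) :
    endpoint w (l ++ m) = endpoint (endpoint w l) m := by
  induction l generalizing w with
  | nil => rfl
  | cons E l ih => exact ih E.term

theorem isWalk_append {A : Type u} {R : Rules A} (w : FreeSemigroup A) (l m : List (Edge R)) :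
    IsWalk w (l ++ m) ↔ IsWalk w l ∧ IsWalk (endpoint w l) m := by
  induction l generalizing w with
  | nil => simp [IsWalk, endpoint]
  | cons E l ih => simp [IsWalk, endpoint, ih, and_assoc]

theorem inv_walk {A : Type u} {R : Rules A} (w : FreeSemigroup A) (l : List (Edge R))
    (h : IsWalk w l) :
    IsWalk (endpoint w l) (l.map Edge.inv).reverse ∧
      endpoint (endpoint w l) (l.map Edge.inv).reverse = w := by
  induction l generalizing w with
  | nil => simp [IsWalk, endpoint]
  | cons E l ih =>
    obtain ⟨h1, h2⟩ := ih E.term h.2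
    rw [List.map_cons, List.reverse_cons, isWalk_append, endpoint_append]
    simp only [endpoint]
    rw [h2]
    exact ⟨⟨h1, E.init_inv, trivial⟩, E.term_inv.trans h.1⟩

theorem act_walk {A : Type u} {R : Rules A} (x y : List A) (w : FreeSemigroup A)
    (l : List (Edge R)) (h : IsWalk w l) :
    IsWalk (sandwich x w y) (l.map fun E => E.act x y) ∧
      endpoint (sandwich x w y) (l.map fun E => E.act x y) = sandwich x (endpoint w l) y := by
  induction l generalizing w with
  | nil => simp [IsWalk, endpoint]
  | cons E l ih =>
    obtain ⟨h1, h2⟩ := ih E.term h.2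
    simp only [List.map_cons, IsWalk, endpoint, Edge.term_act]
    exact ⟨⟨by rw [Edge.init_act, h.1], h1⟩, h2⟩

/-- Paths in the derivation graph of `⟨A | R⟩`, including the empty path at each vertex. -/
@[ext] structure Path {A : Type u} (R : Rules A) : Type u where
  init : FreeSemigroup A
  edges : List (Edge R)
  isWalk : IsWalk init edges

namespace Path

variable {A : Type u} {R : Rules A}

/-- Terminal vertex of a path. -/
def term (P : Path R) : FreeSemigroup A := endpoint P.init P.edges

/-- The empty path `1_w` at the vertex `w`. -/
def empty (w : FreeSemigroup A) : Path R := ⟨w, [], trivial⟩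

/-- The path consisting of one edge. -/
def single (E : Edge R) : Path R := ⟨E.init, [E], rfl, trivial⟩

/-- The composition `P ∘ Q`, defined when the terminal vertex of `P` is the initial vertex
of `Q`. -/
def comp (P Q : Path R) (h : P.term = Q.init) : Path R :=
  ⟨P.init, P.edges ++ Q.edges, (isWalk_append _ _ _).2 ⟨P.isWalk, by
    rw [show endpoint P.init P.edges = Q.init from h]; exact Q.isWalk⟩⟩

/-- The inverse path. -/
def inv (P : Path R) : Path R :=
  ⟨P.term, (P.edges.map Edge.inv).reverse, (inv_walk _ _ P.isWalk).1⟩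

/-- The two-sided action `x · P · y` of `A^*`. -/
def act (x : List A) (P : Path R) (y : List A) : Path R :=
  ⟨sandwich x P.init y, P.edges.map fun E => E.act x y, (act_walk x y _ _ P.isWalk).1⟩

/-- Parallel paths: same initial and same terminal vertex. -/
def Parallel (P Q : Path R) : Prop := P.init = Q.init ∧ P.term = Q.term

theorem term_comp (P Q : Path R) (h : P.term = Q.init) : (P.comp Q h).term = Q.term := by
  have h' : endpoint P.init P.edges = Q.init := h
  simp [term, comp, endpoint_append, h']

theorem init_inv (P : Path R) : P.inv.init = P.term := rfl

theorem term_inv (P : Path R) : P.inv.term = P.init := (inv_walk _ _ P.isWalk).2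

theorem term_act (x : List A) (P : Path R) (y : List A) :
    (P.act x y).term = sandwich x P.term y := (act_walk x y _ _ P.isWalk).2

/-- The path `(E₁ · ιE₂) (τE₁ · E₂)`: first apply `E₁` to the left factor of `ιE₁ ιE₂`, then `E₂`
to the right factor. -/
def leftFirst (E₁ E₂ : Edge R) : Path R :=
  (single (E₁.act [] (letters E₂.init))).comp (single (E₂.act (letters E₁.term) [])) (by
    change (E₁.act [] (letters E₂.init)).term =
      (E₂.act (letters E₁.term) []).init
    rw [Edge.term_act, Edge.init_act]
    exact letters_injective (by simp [letters_sandwich]))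

/-- The path `(ιE₁ · E₂) (E₁ · τE₂)`: first apply `E₂` to the right factor of `ιE₁ ιE₂`, then `E₁`
to the left factor. -/
def rightFirst (E₁ E₂ : Edge R) : Path R :=
  (single (E₂.act (letters E₁.init) [])).comp (single (E₁.act [] (letters E₂.term))) (by
    change (E₂.act (letters E₁.init) []).term =
      (E₁.act [] (letters E₂.term)).init
    rw [Edge.term_act, Edge.init_act]
    exact letters_injective (by simp [letters_sandwich]))

end Path

/-! ### Homotopy relations and finite derivation type -/

/-- Homotopy relations on the set of paths: equivalence relations contained in `Parallel` with the
four closure properties. -/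
structure IsHomotopyRelation {A : Type u} {R : Rules A} (s : Path R → Path R → Prop) : Prop where
  equivalence : Equivalence s
  parallel : ∀ P Q, s P Q → P.Parallel Q
  interchange : ∀ E₁ E₂ : Edge R, s (Path.leftFirst E₁ E₂) (Path.rightFirst E₁ E₂)
  act : ∀ (P Q : Path R) (x y : List A), s P Q → s (P.act x y) (Q.act x y)
  comp : ∀ (P Q T U : Path R) (hTP : T.term = P.init) (hTQ : T.term = Q.init)
    (hPU : P.term = U.init) (hQU : Q.term = U.init), s P Q →
    s ((T.comp P hTP).comp U ((T.term_comp P hTP).trans hPU))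
      ((T.comp Q hTQ).comp U ((T.term_comp Q hTQ).trans hQU))
  inv : ∀ P : Path R, s (P.comp P.inv P.init_inv.symm) (Path.empty P.init)

/-- The homotopy relation generated by a set `C` of pairs of (parallel) paths: the intersection of
all homotopy relations containing `C`. -/
def homotopyGen {A : Type u} {R : Rules A} (C : Set (Path R × Path R)) (P Q : Path R) : Prop :=
  ∀ s : Path R → Path R → Prop, IsHomotopyRelation s → (∀ c ∈ C, s c.1 c.2) → s P Q

/-- `C` is a homotopy base of `⟨A | R⟩`: a set of pairs of parallel paths that generates the
relation of being parallel. -/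
def IsHomotopyBase {A : Type u} {R : Rules A} (C : Set (Path R × Path R)) : Prop :=
  (∀ c ∈ C, c.1.Parallel c.2) ∧ ∀ P Q : Path R, homotopyGen C P Q ↔ P.Parallel Q

/-- A semigroup has finite derivation type if some finite semigroup presentation `⟨A | R⟩`
(with non-empty alphabet) defining it has a finite homotopy base. -/
def HasFiniteDerivationType (S : Type v) [Semigroup S] : Prop :=
  ∃ (A : Type) (_ : Finite A) (_ : Nonempty A) (R : Rules A),
    R.Finite ∧ Defines R S ∧ ∃ C : Set (Path R × Path R), C.Finite ∧ IsHomotopyBase C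

/-! ### Subgroups of semigroups and their cosets -/

/-- The subsemigroup `G` of the semigroup `S` is a subgroup of `S`: it is a group under the
multiplication of `S` (its identity need not be an identity of `S`). -/
def IsSubgroup {S : Type v} [Semigroup S] (G : Subsemigroup S) : Prop :=
  ∃ e ∈ G, (∀ g ∈ G, e * g = g ∧ g * e = g) ∧ ∀ g ∈ G, ∃ h ∈ G, g * h = e ∧ h * g = e

/-- The set `G s`. -/
def translate {S : Type v} [Semigroup S] (G : Subsemigroup S) (s : S) : Set S :=
  (fun g => g * s) '' (G : Set S)

/-- The right cosets of `G` in `S`: the sets `G s`, `s ∈ S`, for which there is `s' ∈ S` with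
`G s s' = G`. -/
def rightCosets {S : Type v} [Semigroup S] (G : Subsemigroup S) : Set (Set S) :=
  {C | ∃ s s' : S, C = translate G s ∧ translate G (s * s') = (G : Set S)}

/-- `G` has finite (right) translational index in `S`: it has finitely many right cosets. -/
def HasFiniteTranslationalIndex {S : Type v} [Semigroup S] (G : Subsemigroup S) : Prop :=
  (rightCosets G).Finite

end FDT

/-!
The proof is a Reidemeister–Schreier rewriting that also keeps track of homotopies.

Let `⟨A | R⟩` be a finite presentation of `S` with a finite homotopy base `C`. The semigroup `S`
acts partially on the right cosets of `G`; collapsing everything else to a dead state gives a finite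
automaton over `A` with state set `σ`. Choosing representatives `r i` and right inverses `r' i`
relative to the identity of `G`, each pair `(i, a)` names the element `r i * a * r' (i a)` of `G`, and
reading a word `w` from the state `i` rewrites it to a word `φ i w` over `σ × A` with value
`r i * w * r' (i w)`. Conversely each letter `b` is spelled by a word `ψ b` over `A` that has the same
value in `S`. The group `G` is defined by the rewritten rules `φ i p = φ i q`, for `(p, q) ∈ R`,
together with the rules `b = φ o (ψ b)`, where `o` is the state `G`.

Paths over `R` are rewritten edge by edge, and this respects homotopy once the pairs of `φ i C` are
declared homotopic: pulling a homotopy relation back along all `φ i` gives a homotopy relation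
(`Rewriting.isHomotopyRelation_pullback`). The rules `b = φ o (ψ b)` compose to a comparison walk
`Λ w` from `w` to `φ o (ψ w)` for every word `w` over `σ × A`. Declare its naturality square to
commute for each of the finitely many rules; by the interchange law it then commutes for every path
`P` from `v` to `w`, that is, `P Λ w ∼ Λ v φ o (ψ P)` (`Rewriting.homotopic_walk_compare`). If `P`
and `Q` are parallel, then so are `ψ P` and `ψ Q`; these are homotopic since `C` is a homotopy base, so
their rewritings are homotopic, and cancelling `Λ w` gives `P ∼ Q`
(`Rewriting.isHomotopyBase_generators`).
-/

namespace FDT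

/-! ### Walks between possibly empty words -/

section Walks

variable {A : Type u} {R : Rules A}

/-- The list of edges `l` is a walk from the word `u` to the word `v`. Words are lists here, so
that the empty word, which is not a vertex and at which only the empty walk starts, needs no
separate treatment. -/
def Joins : List A → List (Edge R) → List A → Prop
  | u, [], v => u = v
  | u, E :: l, v => letters E.init = u ∧ Joins (letters E.term) l v

/-- The two-sided action of `A^*` on lists of edges. -/
def actEdges (x : List A) (l : List (Edge R)) (y : List A) : List (Edge R) :=
  l.map fun E => E.act x y

@[simp] theorem actEdges_nil (x y : List A) : actEdges (R := R) x [] y = [] := rfl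

@[simp] theorem actEdges_cons (x y : List A) (E : Edge R) (l : List (Edge R)) :
    actEdges x (E :: l) y = E.act x y :: actEdges x l y := rfl

@[simp] theorem actEdges_append (x y : List A) (l m : List (Edge R)) :
    actEdges x (l ++ m) y = actEdges x l y ++ actEdges x m y := List.map_append

theorem actEdges_actEdges (x x' y y' : List A) (l : List (Edge R)) :
    actEdges x' (actEdges x l y) y' = actEdges (x' ++ x) l (y ++ y') := by
  simp [actEdges, Edge.act]

@[simp] theorem actEdges_nil_nil (l : List (Edge R)) : actEdges [] l [] = l := by
  simp [actEdges, Edge.act]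

theorem letters_init (E : Edge R) :
    letters E.init = E.left ++ letters (side E.rule E.sign) ++ E.right := letters_sandwich _ _ _

theorem letters_term (E : Edge R) :
    letters E.term = E.left ++ letters (side E.rule !E.sign) ++ E.right := letters_sandwich _ _ _

@[simp] theorem letters_init_act (x y : List A) (E : Edge R) :
    letters (E.act x y).init = x ++ letters E.init ++ y := by
  rw [Edge.init_act, letters_sandwich]

@[simp] theorem letters_term_act (x y : List A) (E : Edge R) :
    letters (E.act x y).term = x ++ letters E.term ++ y := by
  rw [Edge.term_act, letters_sandwich]

theorem exists_letters {u : List A} (h : u ≠ []) : ∃ w : FreeSemigroup A, letters w = u := by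
  cases u with
  | nil => exact absurd rfl h
  | cons a t => exact ⟨⟨a, t⟩, rfl⟩

theorem joins_of_isWalk {w : FreeSemigroup A} {l : List (Edge R)} (h : IsWalk w l) :
    Joins (letters w) l (letters (endpoint w l)) := by
  induction l generalizing w with
  | nil => rfl
  | cons E l ih => exact ⟨by rw [h.1], ih h.2⟩

theorem Joins.isWalk {w : FreeSemigroup A} {l : List (Edge R)} {v : List A}
    (h : Joins (letters w) l v) : IsWalk w l ∧ letters (endpoint w l) = v := by
  induction l generalizing w with
  | nil => exact ⟨trivial, h⟩
  | cons E l ih => exact ⟨⟨letters_injective h.1, (ih h.2).1⟩, (ih h.2).2⟩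

theorem Path.joins (P : Path R) : Joins (letters P.init) P.edges (letters P.term) :=
  joins_of_isWalk P.isWalk

theorem Joins.append {u v w : List A} {l m : List (Edge R)} (h : Joins u l v)
    (h' : Joins v m w) : Joins u (l ++ m) w := by
  induction l generalizing u with
  | nil => cases h; exact h'
  | cons E l ih => exact ⟨h.1, ih h.2⟩

theorem Joins.act {u v : List A} {l : List (Edge R)} (h : Joins u l v) (x y : List A) :
    Joins (x ++ u ++ y) (actEdges x l y) (x ++ v ++ y) := by
  induction l generalizing u with
  | nil => cases h; rfl
  | cons E l ih =>
    refine ⟨by rw [letters_init_act, h.1], ?_⟩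
    rw [letters_term_act]
    exact ih h.2

theorem Joins.inv {u v : List A} {l : List (Edge R)} (h : Joins u l v) :
    Joins v (l.map Edge.inv).reverse u := by
  induction l generalizing u with
  | nil => exact h.symm
  | cons E l ih =>
    rw [List.map_cons, List.reverse_cons]
    exact (ih h.2).append ⟨by rw [Edge.init_inv], by rw [Edge.term_inv]; exact h.1⟩

theorem joins_edge (E : Edge R) : Joins (letters E.init) [E] (letters E.term) := ⟨rfl, rfl⟩

/-- Words joined by a walk are congruent modulo the rules. -/
theorem con_of_walk {w w' : FreeSemigroup A} {l : List (Edge R)}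
    (h : Joins (letters w) l (letters w')) :
    conGen (fun p q : FreeSemigroup A => (p, q) ∈ R) w w' := by
  set c := conGen (fun p q : FreeSemigroup A => (p, q) ∈ R) with hc
  have key : ∀ (x : List A) (p q : FreeSemigroup A) (y : List A), c p q →
      c (sandwich x p y) (sandwich x q y) := by
    intro x p q y hpq
    have right : ∀ p q : FreeSemigroup A, c p q → c (sandwich [] p y) (sandwich [] q y) := by
      intro p q hpq
      by_cases hy : y = []
      · subst hy
        simpa [sandwich] using hpq
      · obtain ⟨t, rfl⟩ := exists_letters hy
        have := c.mul hpq (c.refl t)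
        convert this using 1 <;> exact letters_injective (by simp [letters_sandwich, letters_mul])
    by_cases hx : x = []
    · subst hx
      exact right _ _ hpq
    · obtain ⟨t, rfl⟩ := exists_letters hx
      have := c.mul (c.refl t) (right _ _ hpq)
      convert this using 1 <;> exact letters_injective (by simp [letters_sandwich, letters_mul])
  have edge : ∀ E : Edge R, c E.init E.term := by
    rintro ⟨x, r, b, y⟩
    have hr : c (side r true) (side r false) := ConGen.Rel.of _ _ r.2
    apply key
    cases b
    · exact c.symm hr
    · exact hr
  induction l generalizing w with
  | nil => rw [letters_injective h]; exact c.refl _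
  | cons E l ih =>
    rw [← letters_injective h.1]
    exact c.trans (edge E) (ih h.2)

/-- Congruent words are joined by a walk. -/
theorem exists_walk {w w' : FreeSemigroup A}
    (h : conGen (fun p q : FreeSemigroup A => (p, q) ∈ R) w w') :
    ∃ l : List (Edge R), Joins (letters w) l (letters w') := by
  replace h : ConGen.Rel (fun p q : FreeSemigroup A => (p, q) ∈ R) w w' := h
  induction h with
  | of p q hpq =>
    refine ⟨[⟨[], ⟨(p, q), hpq⟩, true, []⟩], ?_, ?_⟩
    · simp [letters_init, side]
    · simp [Joins, letters_term, side]
  | refl p => exact ⟨[], rfl⟩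
  | symm _ ih =>
    obtain ⟨l, hl⟩ := ih
    exact ⟨_, hl.inv⟩
  | trans _ _ ih ih' =>
    obtain ⟨l, hl⟩ := ih
    obtain ⟨m, hm⟩ := ih'
    exact ⟨_, hl.append hm⟩
  | @mul p p' q q' _ _ ih ih' =>
    obtain ⟨l, hl⟩ := ih
    obtain ⟨m, hm⟩ := ih'
    have h1 := hl.act [] (letters q)
    have h2 := hm.act (letters p') []
    simp only [List.nil_append, List.append_nil] at h1 h2
    exact ⟨_, h1.append h2⟩

end Walks

/-! ### Calculus of homotopies between walks -/

section Homotopies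

variable {A : Type u} {R : Rules A}

/-- The walks `l` and `m` from `u` to `v` are related by the relation `s` on paths. For `u = []`
there are no paths, and the condition only says that `l` and `m` are empty. -/
structure Homotopic (s : Path R → Path R → Prop) (u : List A) (l m : List (Edge R))
    (v : List A) : Prop where
  left : Joins u l v
  right : Joins u m v
  rel : ∀ P Q : Path R, letters P.init = u → letters Q.init = u → P.edges = l → Q.edges = m →
    s P Q

variable {s : Path R → Path R → Prop}

theorem homotopic_of_rel {P Q : Path R} (hP : P.Parallel Q) (h : s P Q) :
    Homotopic s (letters P.init) P.edges Q.edges (letters P.term) := by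
  refine ⟨P.joins, by rw [hP.1, hP.2]; exact Q.joins, ?_⟩
  intro P' Q' h1 h2 h3 h4
  have e1 : P' = P := Path.ext (letters_injective h1) h3
  have e2 : Q' = Q := Path.ext (letters_injective (h2.trans (by rw [hP.1]))) h4
  rw [e1, e2]; exact h

theorem Homotopic.refl (hs : IsHomotopyRelation s) {u v : List A} {l : List (Edge R)}
    (h : Joins u l v) : Homotopic s u l l v := by
  refine ⟨h, h, fun P Q h1 h2 h3 h4 => ?_⟩
  have e : P = Q := Path.ext (letters_injective (h1.trans h2.symm)) (h3.trans h4.symm)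
  rw [e]
  exact hs.equivalence.refl Q

theorem Homotopic.symm (hs : IsHomotopyRelation s) {u v : List A} {l m : List (Edge R)}
    (h : Homotopic s u l m v) : Homotopic s u m l v :=
  ⟨h.right, h.left, fun P Q h1 h2 h3 h4 => hs.equivalence.symm (h.rel Q P h2 h1 h4 h3)⟩

theorem Homotopic.trans (hs : IsHomotopyRelation s) {u v : List A} {l m n : List (Edge R)}
    (h : Homotopic s u l m v) (h' : Homotopic s u m n v) : Homotopic s u l n v := by
  refine ⟨h.left, h'.right, fun P Q h1 h2 h3 h4 => ?_⟩
  subst h1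
  let T : Path R := ⟨P.init, m, h.right.isWalk.1⟩
  exact hs.equivalence.trans (h.rel P T rfl rfl h3 rfl) (h'.rel T Q rfl h2 rfl h4)

/-- Homotopy is a congruence for the composition of walks. -/
theorem Homotopic.comp (hs : IsHomotopyRelation s) {t u v w : List A}
    {l m p q : List (Edge R)} (hp : Joins t p u) (h : Homotopic s u l m v) (hq : Joins v q w) :
    Homotopic s t (p ++ l ++ q) (p ++ m ++ q) w := by
  refine ⟨(hp.append h.left).append hq, (hp.append h.right).append hq, ?_⟩
  intro P Q h1 h2 h3 h4
  by_cases ht : t = []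
  · rw [← h1] at ht; cases ht
  obtain ⟨t, rfl⟩ := exists_letters ht
  obtain ⟨hp', rfl⟩ := hp.isWalk
  obtain ⟨hl, rfl⟩ := h.left.isWalk
  obtain ⟨hm, hlm⟩ := h.right.isWalk
  have hlm := letters_injective hlm
  obtain ⟨hq', rfl⟩ := hq.isWalk
  have key := hs.comp ⟨_, l, hl⟩ ⟨_, m, hm⟩ ⟨t, p, hp'⟩ ⟨_, q, hq'⟩ rfl rfl rfl hlm
    (h.rel _ _ rfl rfl rfl rfl)
  convert key using 1
  · exact Path.ext (letters_injective h1) h3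
  · exact Path.ext (letters_injective h2) h4

theorem Homotopic.append_left (hs : IsHomotopyRelation s) {t u v : List A}
    {l m p : List (Edge R)} (hp : Joins t p u) (h : Homotopic s u l m v) :
    Homotopic s t (p ++ l) (p ++ m) v := by
  simpa using Homotopic.comp hs hp h (q := []) rfl

theorem Homotopic.append_right (hs : IsHomotopyRelation s) {u v w : List A}
    {l m q : List (Edge R)} (h : Homotopic s u l m v) (hq : Joins v q w) :
    Homotopic s u (l ++ q) (m ++ q) w := by
  simpa using Homotopic.comp hs (p := []) rfl h hq

theorem Homotopic.act (hs : IsHomotopyRelation s) {u v : List A} {l m : List (Edge R)}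
    (h : Homotopic s u l m v) (x y : List A) :
    Homotopic s (x ++ u ++ y) (actEdges x l y) (actEdges x m y) (x ++ v ++ y) := by
  refine ⟨h.left.act x y, h.right.act x y, fun P Q h1 h2 h3 h4 => ?_⟩
  by_cases hu : u = []
  · -- At the empty word both walks are empty.
    subst hu
    have nil : ∀ {k : List (Edge R)} {v : List A}, Joins [] k v → k = [] := by
      rintro (_ | ⟨E, k⟩) v hk
      · rfl
      · cases hk.1
    rw [nil h.left] at h3
    rw [nil h.right] at h4
    have e : P = Q := Path.ext (letters_injective (h1.trans h2.symm)) (h3.trans h4.symm)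
    rw [e]
    exact hs.equivalence.refl Q
  obtain ⟨u, rfl⟩ := exists_letters hu
  have key := hs.act ⟨u, l, h.left.isWalk.1⟩ ⟨u, m, h.right.isWalk.1⟩ x y
    (h.rel _ _ rfl rfl rfl rfl)
  convert key using 1
  · exact Path.ext (letters_injective (h1.trans (letters_sandwich _ _ _).symm)) h3
  · exact Path.ext (letters_injective (h2.trans (letters_sandwich _ _ _).symm)) h4

theorem homotopic_inv (hs : IsHomotopyRelation s) {u v : List A} {l : List (Edge R)}
    (h : Joins u l v) : Homotopic s u (l ++ (l.map Edge.inv).reverse) [] u := by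
  refine ⟨h.append h.inv, rfl, fun P Q h1 h2 h3 h4 => ?_⟩
  subst h1
  have key := hs.inv ⟨P.init, l, h.isWalk.1⟩
  convert key using 1
  · exact Path.ext rfl h3
  · exact Path.ext (letters_injective h2) h4

theorem Homotopic.cancel_right (hs : IsHomotopyRelation s) {u v w : List A}
    {l m k : List (Edge R)} (hl : Joins u l v) (hm : Joins u m v) (hk : Joins v k w)
    (h : Homotopic s u (l ++ k) (m ++ k) w) : Homotopic s u l m v := by
  have h1 := h.append_right hs hk.inv
  have h2 := (homotopic_inv hs hk).append_left hs hl
  have h3 := (homotopic_inv hs hk).append_left hs hm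
  simp only [List.append_nil, ← List.append_assoc] at h2 h3
  exact ((h2.symm hs).trans hs h1).trans hs h3

theorem homotopic_interchange_edges (hs : IsHomotopyRelation s) (E F : Edge R) :
    Homotopic s (letters E.init ++ letters F.init)
      [E.act [] (letters F.init), F.act (letters E.term) []]
      [F.act (letters E.init) [], E.act [] (letters F.term)]
      (letters E.term ++ letters F.term) := by
  have h := hs.interchange E F
  have := homotopic_of_rel (hs.parallel _ _ h) h
  have e1 : letters (Path.leftFirst E F).init = letters E.init ++ letters F.init :=
    letters_init_act _ _ _
  have e2 : letters (Path.leftFirst E F).term = letters E.term ++ letters F.term := by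
    rw [Path.leftFirst, Path.term_comp]
    exact (letters_term_act _ _ _).trans (List.append_nil _)
  rwa [e1, e2] at this

theorem homotopic_interchange_edge (hs : IsHomotopyRelation s) (E : Edge R) {v v' : List A}
    {m : List (Edge R)} (h : Joins v m v') :
    Homotopic s (letters E.init ++ v)
      (E.act [] v :: actEdges (letters E.term) m [])
      (actEdges (letters E.init) m [] ++ [E.act [] v'])
      (letters E.term ++ v') := by
  induction m generalizing v with
  | nil =>
    obtain rfl : v = v' := h
    have := (joins_edge E).act [] v
    exact Homotopic.refl hs (by simpa using this)
  | cons F m ih =>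
    obtain ⟨rfl, h⟩ := h
    have h1 := (homotopic_interchange_edges hs E F).append_right hs
      (by simpa using h.act (letters E.term) [])
    have h2 := (ih h).append_left hs (by simpa using (joins_edge F).act (letters E.init) [])
    exact h1.trans hs h2

/-- The interchange law for walks: a walk in the left factor of a product of two words commutes
with a walk in the right factor. -/
theorem homotopic_interchange (hs : IsHomotopyRelation s) {u u' v v' : List A}
    {l m : List (Edge R)} (hl : Joins u l u') (hm : Joins v m v') :
    Homotopic s (u ++ v) (actEdges [] l v ++ actEdges u' m [])
      (actEdges u m [] ++ actEdges [] l v') (u' ++ v') := by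
  induction l generalizing u with
  | nil =>
    obtain rfl : u = u' := hl
    have := hm.act u []
    simpa using Homotopic.refl hs this
  | cons E l ih =>
    obtain ⟨rfl, hl⟩ := hl
    have h1 := (ih hl).append_left hs (by simpa using (joins_edge E).act [] v)
    have h2 := (homotopic_interchange_edge hs E hm).append_right hs
      (by simpa using hl.act [] v')
    simp only [List.cons_append, List.nil_append, List.append_assoc] at h1 h2
    exact h1.trans hs h2

/-- Being parallel is a homotopy relation. -/
theorem isHomotopyRelation_parallel :
    IsHomotopyRelation (Path.Parallel : Path R → Path R → Prop) where
  equivalence := ⟨fun _ => ⟨rfl, rfl⟩, fun h => ⟨h.1.symm, h.2.symm⟩,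
    fun h h' => ⟨h.1.trans h'.1, h.2.trans h'.2⟩⟩
  parallel _ _ h := h
  interchange E F := by
    refine ⟨letters_injective ?_, letters_injective ?_⟩
    · exact (letters_init_act _ _ _).trans
        ((List.append_nil _).symm.trans (letters_init_act _ _ _).symm)
    · rw [Path.leftFirst, Path.rightFirst, Path.term_comp, Path.term_comp]
      exact (letters_term_act (letters E.term) [] F).trans
        ((List.append_nil _).trans (letters_term_act [] (letters F.term) E).symm)
  act P Q x y h := ⟨congrArg (sandwich x · y) h.1, by rw [Path.term_act, Path.term_act, h.2]⟩
  comp P Q T U _ _ _ _ _ := ⟨rfl, by rw [Path.term_comp, Path.term_comp]⟩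
  inv P := ⟨rfl, by rw [Path.term_comp, Path.term_inv]; rfl⟩

end Homotopies

/-! ### Rewriting words along a finite automaton -/

section Rewriting

variable {A σ : Type u} {R : Rules A}

/-- The data of a Reidemeister–Schreier rewriting process for `⟨A | R⟩`: an automaton with
transition function `step`, whose states stand for the cosets of a subgroup, and for each letter
`(i, a)` of the new alphabet `σ × A` a word over `A` which spells the generator named by it. Cosets
are acted on partially; states that are not `alive` are sinks which make `step` total. -/
structure Rewriting (R : Rules A) (σ : Type u) where
  step : σ → A → σ
  alive : σ → Prop
  base : σ
  word : σ × A → FreeSemigroup A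
  alive_of_step : ∀ i a, alive (step i a) → alive i
  foldl_rule : ∀ i, ∀ p ∈ R, (letters p.1).foldl step i = (letters p.2).foldl step i
  alive_base : alive base
  foldl_word : ∀ b, (letters (word b)).foldl step base = base

namespace Rewriting

variable (D : Rewriting R σ)

/-- The state reached from `i` by reading `w`. -/
def run (i : σ) (w : List A) : σ := w.foldl D.step i

@[simp] theorem run_nil (i : σ) : D.run i [] = i := rfl

@[simp] theorem run_append (i : σ) (x y : List A) : D.run i (x ++ y) = D.run (D.run i x) y :=
  List.foldl_append

theorem alive_of_run {i : σ} {w : List A} (h : D.alive (D.run i w)) : D.alive i := by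
  induction w generalizing i with
  | nil => exact h
  | cons a w ih => exact D.alive_of_step _ _ (ih h)

/-- The word over `σ × A` obtained by pairing each letter of a word over `A` with the state in
which it is read, starting from the state `i`. -/
def rewrite (i : σ) : List A → List (σ × A)
  | [] => []
  | a :: w => (i, a) :: rewrite (D.step i a) w

@[simp] theorem rewrite_nil (i : σ) : D.rewrite i [] = [] := rfl

@[simp] theorem rewrite_append (i : σ) (x y : List A) :
    D.rewrite i (x ++ y) = D.rewrite i x ++ D.rewrite (D.run i x) y := by
  induction x generalizing i with
  | nil => rfl
  | cons a x ih => simp [rewrite, ih, run]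

/-- The rewriting map on non-empty words. -/
def rewriteWord (i : σ) (w : FreeSemigroup A) : FreeSemigroup (σ × A) :=
  ⟨(i, w.head), D.rewrite (D.step i w.head) w.tail⟩

@[simp] theorem letters_rewriteWord (i : σ) (w : FreeSemigroup A) :
    letters (D.rewriteWord i w) = D.rewrite i (letters w) := rfl

/-- The word over `A` spelled by a word over `σ × A`. -/
def spell (w : List (σ × A)) : List A := w.flatMap fun b => letters (D.word b)

@[simp] theorem spell_nil : D.spell [] = [] := rfl

@[simp] theorem spell_cons (b : σ × A) (w : List (σ × A)) :
    D.spell (b :: w) = letters (D.word b) ++ D.spell w := rfl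

@[simp] theorem spell_append (x y : List (σ × A)) :
    D.spell (x ++ y) = D.spell x ++ D.spell y := List.flatMap_append

@[simp] theorem run_spell (w : List (σ × A)) : D.run D.base (D.spell w) = D.base := by
  induction w with
  | nil => rfl
  | cons b w ih => rw [spell_cons, run_append, show D.run D.base (letters (D.word b)) = D.base from
      D.foldl_word b, ih]

theorem letters_lift (w : FreeSemigroup (σ × A)) :
    letters (FreeSemigroup.lift D.word w) = D.spell (letters w) := by
  induction w using FreeSemigroup.recOnMul with
  | ih1 b => rw [FreeSemigroup.lift_of]; exact (List.append_nil _).symm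
  | ih2 b w h1 h2 => rw [map_mul, letters_mul, h1, h2, letters_mul, spell_append]

/-- The defining relations over `σ × A`: the rewritten rules of `R`, and for each letter `b` the
relation between `b` and the rewriting of the word that `b` spells. -/
def rules : Rules (σ × A) :=
  {p | ∃ i, ∃ q ∈ R, D.alive (D.run i (letters q.1)) ∧
    p = (D.rewriteWord i q.1, D.rewriteWord i q.2)} ∪
  Set.range fun b => (FreeSemigroup.of b, D.rewriteWord D.base (D.word b))

theorem finite_rules [Finite A] [Finite σ] (hR : R.Finite) : D.rules.Finite := by
  refine Set.Finite.union ?_ (Set.finite_range _)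
  refine ((Set.finite_univ (α := σ)).prod hR |>.image
    fun x => (D.rewriteWord x.1 x.2.1, D.rewriteWord x.1 x.2.2)).subset ?_
  rintro _ ⟨i, q, hq, -, rfl⟩
  exact ⟨(i, q), ⟨trivial, hq⟩, rfl⟩

/-- The relation between the letter `b` and the rewriting of the word that `b` spells. -/
def letterRule (b : σ × A) : D.rules := ⟨_, Or.inr ⟨b, rfl⟩⟩

open Classical in
/-- The rewriting of a rule from the state `i`; if this runs into a dead state there is no such
relation, and the value is an arbitrary one. -/
noncomputable def rule (i : σ) (r : R) : D.rules :=
  if h : D.alive (D.run i (letters r.1.1)) then ⟨_, Or.inl ⟨i, r.1, r.2, h, rfl⟩⟩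
  else D.letterRule (i, r.1.1.head)

theorem run_side (i : σ) (r : R) (b : Bool) :
    D.run i (letters (side r b)) = D.run i (letters (side r true)) := by
  cases b
  · exact (D.foldl_rule i r.1 r.2).symm
  · rfl

theorem letters_side_rule {i : σ} {r : R} (h : D.alive (D.run i (letters (side r true))))
    (b : Bool) : letters (side (D.rule i r) b) = D.rewrite i (letters (side r b)) := by
  rw [rule, dif_pos (show D.alive (D.run i (letters r.1.1)) from h)]
  cases b <;> rfl

/-- The rewriting of an edge of the derivation graph of `R` from the state `i`. It fits the
rewriting of the vertices if no dead state is met. -/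
noncomputable def edge (i : σ) (E : Edge R) : Edge D.rules :=
  ⟨D.rewrite i E.left, D.rule (D.run i E.left) E.rule, E.sign,
    D.rewrite (D.run i (E.left ++ letters (side E.rule true))) E.right⟩

theorem run_term (i : σ) (E : Edge R) :
    D.run i (letters E.term) = D.run i (letters E.init) := by
  simp only [letters_init, letters_term, run_append]
  rw [D.run_side _ _ E.sign, D.run_side _ _ !E.sign]

theorem alive_rule {i : σ} {E : Edge R} (h : D.alive (D.run i (letters E.init))) :
    D.alive (D.run (D.run i E.left) (letters (side E.rule true))) := by
  rw [letters_init, run_append, run_append, run_side] at h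
  exact D.alive_of_run h

theorem letters_init_edge {i : σ} {E : Edge R} (h : D.alive (D.run i (letters E.init))) :
    letters (D.edge i E).init = D.rewrite i (letters E.init) := by
  rw [letters_init, letters_init, edge, D.letters_side_rule (D.alive_rule h)]
  simp only [rewrite_append, run_append, D.run_side _ _ E.sign]

theorem letters_term_edge {i : σ} {E : Edge R} (h : D.alive (D.run i (letters E.init))) :
    letters (D.edge i E).term = D.rewrite i (letters E.term) := by
  rw [letters_term, letters_term, edge, D.letters_side_rule (D.alive_rule h)]
  simp only [rewrite_append, run_append, D.run_side _ _ !E.sign]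

theorem edge_act (i : σ) (x y : List A) (E : Edge R) :
    D.edge i (E.act x y) =
      (D.edge (D.run i x) E).act (D.rewrite i x)
        (D.rewrite (D.run i (x ++ letters E.init)) y) := by
  simp only [edge, Edge.act, letters_init, rewrite_append, run_append, D.run_side _ _ E.sign]

theorem edge_inv (i : σ) (E : Edge R) : D.edge i E.inv = (D.edge i E).inv := rfl

theorem run_eq_of_joins (i : σ) {u v : List A} {l : List (Edge R)} (h : Joins u l v) :
    D.run i v = D.run i u := by
  induction l generalizing u with
  | nil => rw [show u = v from h]
  | cons E l ih => rw [ih h.2, ← h.1, run_term]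

theorem joins_map_edge {i : σ} {u v : List A} {l : List (Edge R)} (h : Joins u l v)
    (hu : D.alive (D.run i u)) :
    Joins (D.rewrite i u) (l.map (D.edge i)) (D.rewrite i v) := by
  induction l generalizing u with
  | nil => rw [show u = v from h]; rfl
  | cons E l ih =>
    obtain ⟨rfl, h⟩ := h
    refine ⟨D.letters_init_edge hu, ?_⟩
    rw [D.letters_term_edge hu]
    exact ih h (by rwa [run_term])

theorem map_edge_act (i : σ) {u v : List A} {l : List (Edge R)} (h : Joins u l v)
    (x y : List A) :
    (actEdges x l y).map (D.edge i) =
      actEdges (D.rewrite i x) (l.map (D.edge (D.run i x)))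
        (D.rewrite (D.run i (x ++ u)) y) := by
  induction l generalizing u with
  | nil => rfl
  | cons E l ih =>
    have e : D.run i (x ++ letters E.term) = D.run i (x ++ u) := by
      rw [← h.1, run_append, run_append, run_term]
    rw [actEdges_cons, List.map_cons, List.map_cons, actEdges_cons, edge_act, ih h.2, e, h.1]

/-! ### Homotopic walks have homotopic rewritings -/

/-- Pulling back a homotopy relation over `D.rules` along all rewriting maps gives a homotopy
relation over `R`. -/
theorem isHomotopyRelation_pullback {s : Path D.rules → Path D.rules → Prop}
    (hs : IsHomotopyRelation s) :
    IsHomotopyRelation fun P Q : Path R => P.Parallel Q ∧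
      ∀ i, D.alive (D.run i (letters P.init)) →
        Homotopic s (D.rewrite i (letters P.init)) (P.edges.map (D.edge i))
          (Q.edges.map (D.edge i)) (D.rewrite i (letters P.term)) where
  equivalence := by
    refine ⟨fun P => ⟨⟨rfl, rfl⟩, fun i hi => .refl hs (D.joins_map_edge P.joins hi)⟩,
      ?_, ?_⟩
    · rintro P Q ⟨⟨h1, h2⟩, h⟩
      refine ⟨⟨h1.symm, h2.symm⟩, ?_⟩
      rw [← h1, ← h2]
      exact fun i hi => (h i hi).symm hs
    · rintro P Q T ⟨⟨h1, h2⟩, h⟩ ⟨⟨h1', h2'⟩, h'⟩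
      refine ⟨⟨h1.trans h1', h2.trans h2'⟩, fun i hi => (h i hi).trans hs ?_⟩
      rw [h1] at hi ⊢
      rw [h2]
      exact h' i hi
  parallel _ _ h := h.1
  interchange E F := by
    refine ⟨isHomotopyRelation_parallel.interchange E F, fun i hi => ?_⟩
    have e1 : letters (Path.leftFirst E F).init = letters E.init ++ letters F.init :=
      letters_init_act _ _ _
    have e2 : letters (Path.leftFirst E F).term = letters E.term ++ letters F.term := by
      rw [Path.leftFirst, Path.term_comp]
      exact (letters_term_act _ _ _).trans (List.append_nil _)
    rw [e1] at hi ⊢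
    rw [e2]
    rw [run_append] at hi
    have hE := D.alive_of_run hi
    have key := homotopic_interchange_edges hs (D.edge i E) (D.edge (D.run i (letters E.init)) F)
    rw [D.letters_init_edge hE, D.letters_term_edge hE, D.letters_init_edge hi,
      D.letters_term_edge hi] at key
    simpa [Path.leftFirst, Path.rightFirst, Path.comp, Path.single, edge_act, run_term]
      using key
  act P Q x y h := by
    refine ⟨isHomotopyRelation_parallel.act P Q x y h.1, fun i hi => ?_⟩
    have e1 : letters (P.act x y).init = x ++ letters P.init ++ y := letters_sandwich _ _ _
    have e2 : letters (P.act x y).term = x ++ letters P.term ++ y := by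
      rw [Path.term_act, letters_sandwich]
    rw [e1] at hi ⊢
    rw [e2]
    rw [run_append] at hi
    have hi' := D.alive_of_run hi
    rw [run_append] at hi'
    have key := (h.2 _ hi').act hs (D.rewrite i x) (D.rewrite (D.run i (x ++ letters P.init)) y)
    have hQ := Q.joins
    rw [← h.1.1] at hQ
    rw [← D.map_edge_act i P.joins, ← D.map_edge_act i hQ] at key
    simpa [Path.act, actEdges, D.run_eq_of_joins _ P.joins] using key
  comp P Q T U hTP hTQ hPU hQU h := by
    refine ⟨isHomotopyRelation_parallel.comp P Q T U hTP hTQ hPU hQU h.1, fun i hi => ?_⟩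
    have hP : D.alive (D.run i (letters P.init)) := by
      rw [← hTP, D.run_eq_of_joins i T.joins]; exact hi
    have hU : D.alive (D.run i (letters U.init)) := by
      rw [← hPU, D.run_eq_of_joins i P.joins]; exact hP
    have h1 := D.joins_map_edge T.joins hi
    have h2 := D.joins_map_edge U.joins hU
    rw [hTP] at h1
    rw [← hPU] at h2
    have key := Homotopic.comp hs h1 (h.2 i hP) h2
    rw [Path.term_comp (T.comp P hTP)]
    simpa [Path.comp] using key
  inv P := by
    refine ⟨isHomotopyRelation_parallel.inv P, fun i hi => ?_⟩
    have key := homotopic_inv hs (D.joins_map_edge P.joins hi)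
    rw [Path.term_comp, Path.term_inv]
    have e : (P.edges.map (D.edge i)).map Edge.inv = (P.edges.map Edge.inv).map (D.edge i) := by
      simp [edge_inv]
    rw [e, ← List.map_reverse, ← List.map_append] at key
    exact key

/-! ### The comparison walks -/

/-- A walk from the word `w` to the rewriting of the word spelled by `w`. -/
def compare : List (σ × A) → List (Edge D.rules)
  | [] => []
  | b :: w => ⟨[], D.letterRule b, true, w⟩ ::
      actEdges (D.rewrite D.base (letters (D.word b))) (compare w) []

@[simp] theorem compare_nil : D.compare [] = [] := rfl

/-- The rewriting of the word spelled by `w`. -/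
def normal (w : List (σ × A)) : List (σ × A) := D.rewrite D.base (D.spell w)

@[simp] theorem normal_append (x y : List (σ × A)) :
    D.normal (x ++ y) = D.normal x ++ D.normal y := by
  simp [normal]

theorem joins_compare (w : List (σ × A)) : Joins w (D.compare w) (D.normal w) := by
  induction w with
  | nil => rfl
  | cons b w ih =>
    refine ⟨letters_init _, ?_⟩
    have := ih.act (D.rewrite D.base (letters (D.word b))) []
    convert this using 1
    · simp [letters_term, letterRule, side]
    · simp [normal, run, D.foldl_word]

theorem compare_append (x y : List (σ × A)) :
    D.compare (x ++ y) = actEdges [] (D.compare x) y ++ actEdges (D.normal x) (D.compare y) [] := by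
  induction x with
  | nil => simp [normal]
  | cons b x ih =>
    have e : D.normal (b :: x) = D.rewrite D.base (letters (D.word b)) ++ D.normal x := by
      simp [normal, run, D.foldl_word]
    simp [compare, ih, actEdges_actEdges, e, Edge.act]

/-! ### A homotopy base over the new alphabet -/

/-- The edges over `R` spelled by an edge over `D.rules`, given walks `Ψ` that relate the words
spelled by the two sides of a rule. -/
def spellEdge (Ψ : D.rules → Bool → List (Edge R)) (E : Edge D.rules) : List (Edge R) :=
  actEdges (D.spell E.left) (Ψ E.rule E.sign) (D.spell E.right)

/-- Generators for a homotopy base over `D.rules`, as triples consisting of an initial vertex and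
two walks: the rewritings of a homotopy base `C` over `R`, and for each rule of `D.rules` and each
orientation the naturality square of the comparison walks. -/
def generators (C : Set (Path R × Path R)) (Ψ : D.rules → Bool → List (Edge R)) :
    Set (FreeSemigroup (σ × A) × List (Edge D.rules) × List (Edge D.rules)) :=
  (fun x : σ × Path R × Path R => (D.rewriteWord x.1 x.2.1.init, x.2.1.edges.map (D.edge x.1),
    x.2.2.edges.map (D.edge x.1))) '' (Set.univ ×ˢ C) ∪
  Set.range fun x : D.rules × Bool => (side x.1 x.2,
    ⟨[], x.1, x.2, []⟩ :: D.compare (letters (side x.1 !x.2)),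
    D.compare (letters (side x.1 x.2)) ++ (Ψ x.1 x.2).map (D.edge D.base))

/-- The pairs of parallel paths described by a set of triples. -/
def pathPairs {B : Type u} {Q : Rules B}
    (T : Set (FreeSemigroup B × List (Edge Q) × List (Edge Q))) : Set (Path Q × Path Q) :=
  {p | p.1.Parallel p.2 ∧ (p.1.init, p.1.edges, p.2.edges) ∈ T}

theorem finite_pathPairs {B : Type u} {Q : Rules B}
    {T : Set (FreeSemigroup B × List (Edge Q) × List (Edge Q))} (hT : T.Finite) :
    (pathPairs T).Finite := by
  refine Set.Finite.of_finite_image (f := fun p => (p.1.init, p.1.edges, p.2.edges))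
    (hT.subset ?_) ?_
  · rintro _ ⟨p, hp, rfl⟩
    exact hp.2
  · rintro ⟨P, P'⟩ ⟨h, -⟩ ⟨Q, Q'⟩ ⟨h', -⟩ e
    simp only [Prod.mk.injEq] at e
    have e1 : P = Q := Path.ext e.1 e.2.1
    have e2 : P' = Q' := Path.ext (by rw [← h.1, ← h'.1]; exact e.1) e.2.2
    rw [e1, e2]

theorem homotopic_of_mem {B : Type u} {Q : Rules B}
    {T : Set (FreeSemigroup B × List (Edge Q) × List (Edge Q))} {s : Path Q → Path Q → Prop}
    (hT : ∀ c ∈ pathPairs T, s c.1 c.2) {w : FreeSemigroup B} {l m : List (Edge Q)} {v : List B}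
    (h : (w, l, m) ∈ T) (hl : Joins (letters w) l v) (hm : Joins (letters w) m v) :
    Homotopic s (letters w) l m v := by
  have hp : Path.Parallel (⟨w, l, hl.isWalk.1⟩ : Path Q) ⟨w, m, hm.isWalk.1⟩ :=
    ⟨rfl, letters_injective (hl.isWalk.2.trans hm.isWalk.2.symm)⟩
  have := homotopic_of_rel hp (hT (_, _) ⟨hp, h⟩)
  rwa [show letters (Path.term ⟨w, l, hl.isWalk.1⟩) = v from hl.isWalk.2] at this

variable {Ψ : D.rules → Bool → List (Edge R)}

theorem joins_spellEdge
    (hΨ : ∀ ρ b, Joins (D.spell (letters (side ρ b))) (Ψ ρ b) (D.spell (letters (side ρ !b))))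
    (E : Edge D.rules) :
    Joins (D.spell (letters E.init)) (D.spellEdge Ψ E) (D.spell (letters E.term)) := by
  simpa [letters_init, letters_term, spellEdge] using
    (hΨ E.rule E.sign).act (D.spell E.left) (D.spell E.right)

/-- Naturality of the comparison walks with respect to the edges over `D.rules`. -/
theorem homotopic_edge_compare {C : Set (Path R × Path R)}
    (hΨ : ∀ ρ b, Joins (D.spell (letters (side ρ b))) (Ψ ρ b) (D.spell (letters (side ρ !b))))
    {s : Path D.rules → Path D.rules → Prop} (hs : IsHomotopyRelation s)
    (hC : ∀ c ∈ pathPairs (D.generators C Ψ), s c.1 c.2) (E : Edge D.rules) :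
    Homotopic s (letters E.init) (E :: D.compare (letters E.term))
      (D.compare (letters E.init) ++ (D.spellEdge Ψ E).map (D.edge D.base))
      (D.normal (letters E.term)) := by
  obtain ⟨x, ρ, b, y⟩ := E
  set m := letters (side ρ b) with hm
  set m' := letters (side ρ !b) with hm'
  set F := (Ψ ρ b).map (D.edge D.base) with hF
  set e : Edge D.rules := ⟨[], ρ, b, []⟩ with he
  have hFj : Joins (D.normal m) F (D.normal m') :=
    D.joins_map_edge (hΨ ρ b) (by rw [run_spell]; exact D.alive_base)
  have hej : Joins m [e] m' := by
    simpa [letters_init, letters_term, he] using joins_edge e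
  have h0 : Homotopic s m (e :: D.compare m') (D.compare m ++ F) (D.normal m') :=
    homotopic_of_mem hC (Or.inr ⟨(ρ, b), rfl⟩) (hej.append (D.joins_compare m'))
      ((D.joins_compare m).append hFj)
  -- The spelled edge, rewritten from the base state, is `F` between rewritten words.
  have hFE : (D.spellEdge Ψ ⟨x, ρ, b, y⟩).map (D.edge D.base) =
      actEdges (D.normal x) F (D.normal y) := by
    rw [spellEdge, D.map_edge_act _ (hΨ ρ b)]
    simp [normal, hF]
  have h1 := homotopic_interchange hs (D.joins_compare x)
    (by simpa using hej.act [] y : Joins (m ++ y) [e.act [] y] (m' ++ y))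
  have h2 := h0.act hs (D.normal x) y
  have h3 := (homotopic_interchange hs hFj (D.joins_compare y)).act hs (D.normal x) []
  have j1 := (D.joins_compare x).act [] (m ++ y)
  have j2 := (D.joins_compare m').act (D.normal x) y
  have j3 := (D.joins_compare y).act (D.normal x ++ D.normal m') []
  have j4 := (D.joins_compare m).act (D.normal x) y
  simp only [actEdges_cons, actEdges_nil, actEdges_append, actEdges_actEdges, Edge.act,
    List.append_nil, List.nil_append, List.append_assoc, List.cons_append, he]
    at h1 h2 h3 j1 j2 j3 j4
  have k1 := (h1.symm hs).append_right hs (j2.append j3)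
  have k2 := (h2.append_left hs j1).append_right hs j3
  have k3 := (h3.append_left hs j4).append_left hs j1
  rw [hFE]
  simp only [letters_init, letters_term, compare_append, normal_append, actEdges_append,
    actEdges_actEdges, List.append_nil, List.nil_append, List.append_assoc, List.cons_append,
    ← hm, ← hm'] at k1 k2 k3 ⊢
  exact (k1.trans hs k2).trans hs k3

/-- Naturality of the comparison walks with respect to walks over `D.rules`. -/
theorem homotopic_walk_compare {C : Set (Path R × Path R)}
    (hΨ : ∀ ρ b, Joins (D.spell (letters (side ρ b))) (Ψ ρ b) (D.spell (letters (side ρ !b))))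
    {s : Path D.rules → Path D.rules → Prop} (hs : IsHomotopyRelation s)
    (hC : ∀ c ∈ pathPairs (D.generators C Ψ), s c.1 c.2) {u v : List (σ × A)}
    {l : List (Edge D.rules)} (h : Joins u l v) :
    Joins (D.spell u) (l.flatMap (D.spellEdge Ψ)) (D.spell v) ∧
    Homotopic s u (l ++ D.compare v)
      (D.compare u ++ (l.flatMap (D.spellEdge Ψ)).map (D.edge D.base)) (D.normal v) := by
  induction l generalizing u with
  | nil =>
    obtain rfl : u = v := h
    exact ⟨rfl, by simpa using Homotopic.refl hs (D.joins_compare u)⟩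
  | cons E l ih =>
    obtain ⟨rfl, h⟩ := h
    obtain ⟨hj, ih⟩ := ih h
    have hE := D.joins_spellEdge hΨ E
    refine ⟨hE.append hj, ?_⟩
    have k1 := ih.append_left hs (joins_edge E)
    have k2 := (D.homotopic_edge_compare hΨ hs hC E).append_right hs
      (D.joins_map_edge hj (by rw [run_spell]; exact D.alive_base))
    simp only [List.cons_append, List.nil_append, List.append_assoc] at k1 k2
    simpa using k1.trans hs k2

/-- The rewritings of a homotopy base, together with the naturality squares of the comparison
walks, are a homotopy base: a walk over `D.rules` is determined up to homotopy by the rewriting of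
the walk it spells over `R`. -/
theorem isHomotopyBase_generators {C : Set (Path R × Path R)} (hC : IsHomotopyBase C)
    (hΨ : ∀ ρ b, Joins (D.spell (letters (side ρ b))) (Ψ ρ b) (D.spell (letters (side ρ !b)))) :
    IsHomotopyBase (pathPairs (D.generators C Ψ)) := by
  refine ⟨fun c hc => hc.1, fun P Q => ⟨fun h => h _ isHomotopyRelation_parallel
    fun c hc => hc.1, fun hPQ s hs hsC => ?_⟩⟩
  have hQ := Q.joins
  rw [← hPQ.1, ← hPQ.2] at hQ
  obtain ⟨jP, kP⟩ := D.homotopic_walk_compare hΨ hs hsC P.joins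
  obtain ⟨jQ, kQ⟩ := D.homotopic_walk_compare hΨ hs hsC hQ
  have base : D.alive (D.run D.base (D.spell (letters P.init))) := by
    rw [run_spell]; exact D.alive_base
  -- The spelled walks are parallel, hence homotopic over `R`, hence so are their rewritings.
  have key : Homotopic s (D.normal (letters P.init))
      ((P.edges.flatMap (D.spellEdge Ψ)).map (D.edge D.base))
      ((Q.edges.flatMap (D.spellEdge Ψ)).map (D.edge D.base)) (D.normal (letters P.term)) := by
    let w := FreeSemigroup.lift D.word P.init
    have hw : letters w = D.spell (letters P.init) := D.letters_lift _
    rw [← hw] at jP jQ base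
    let P' : Path R := ⟨w, _, jP.isWalk.1⟩
    let Q' : Path R := ⟨w, _, jQ.isWalk.1⟩
    have hP' : letters P'.term = D.spell (letters P.term) := jP.isWalk.2
    have hQ' : letters Q'.term = D.spell (letters P.term) := jQ.isWalk.2
    have := ((hC.2 P' Q').2 ⟨rfl, letters_injective (hP'.trans hQ'.symm)⟩ _
      (D.isHomotopyRelation_pullback hs) ?_).2 D.base base
    · rw [hP', show P'.init = w from rfl, hw] at this
      exact this
    · intro c hc
      have hp := hC.1 c hc
      refine ⟨hp, fun i hi => ?_⟩
      have hj := c.2.joins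
      rw [← hp.1, ← hp.2] at hj
      exact homotopic_of_mem hsC (Or.inl ⟨(i, c), ⟨trivial, hc⟩, rfl⟩)
        (D.joins_map_edge c.1.joins hi) (D.joins_map_edge hj hi)
  have k := (kP.trans hs (key.append_left hs (D.joins_compare _))).trans hs (kQ.symm hs)
  exact (k.cancel_right hs P.joins hQ (D.joins_compare _)).rel P Q rfl
    (by rw [hPQ.1]) rfl rfl

theorem finite_generators [Finite A] [Finite σ] (hR : R.Finite) {C : Set (Path R × Path R)}
    (hC : C.Finite) : (D.generators C Ψ).Finite := by
  have := (D.finite_rules hR).to_subtype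
  exact ((Set.finite_univ.prod hC).image _).union (Set.finite_range _)

/-- A semigroup `G` has finite derivation type if it is generated by a family `val` satisfying the
rewritten rules, whose members agree with the rewritings of the words they spell, and such that
words with the same value in `G` spell congruent words over `R`. -/
theorem hasFiniteDerivationType {A σ : Type} {R : Rules A} (D : Rewriting R σ) [Finite A]
    [Finite σ] [Nonempty A] (hR : R.Finite) {C : Set (Path R × Path R)} (hCfin : C.Finite)
    (hC : IsHomotopyBase C) {G : Type v} [Semigroup G] (val : FreeSemigroup (σ × A) →ₙ* G)
    (hval : Function.Surjective val)
    (hrule : ∀ i, ∀ q ∈ R, D.alive (D.run i (letters q.1)) →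
      val (D.rewriteWord i q.1) = val (D.rewriteWord i q.2))
    (hletter : ∀ b, val (FreeSemigroup.of b) = val (D.rewriteWord D.base (D.word b)))
    (hspell : ∀ w w', val w = val w' → conGen (fun p q : FreeSemigroup A => (p, q) ∈ R)
      (FreeSemigroup.lift D.word w) (FreeSemigroup.lift D.word w')) :
    HasFiniteDerivationType G := by
  have hrules : ∀ p ∈ D.rules, val p.1 = val p.2 := by
    rintro p (⟨i, q, hq, hi, rfl⟩ | ⟨b, rfl⟩)
    · exact hrule i q hq hi
    · exact hletter b
  have hΨ : ∀ (ρ : D.rules) (b : Bool), ∃ l : List (Edge R),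
      Joins (D.spell (letters (side ρ b))) l (D.spell (letters (side ρ !b))) := by
    intro ρ b
    rw [← letters_lift, ← letters_lift]
    refine exists_walk (hspell _ _ ?_)
    cases b
    · exact (hrules _ ρ.2).symm
    · exact hrules _ ρ.2
  choose Ψ hΨ using hΨ
  refine ⟨σ × A, inferInstance, ⟨(D.base, Classical.arbitrary A)⟩, D.rules, D.finite_rules hR, ?_,
    _, finite_pathPairs (D.finite_generators hR hCfin), D.isHomotopyBase_generators hC hΨ⟩
  -- A word is congruent to the rewriting of the word it spells.
  have hcompare : ∀ w, conGen (fun p q : FreeSemigroup (σ × A) => (p, q) ∈ D.rules) w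
      (D.rewriteWord D.base (FreeSemigroup.lift D.word w)) := by
    intro w
    refine con_of_walk (l := D.compare (letters w)) ?_
    rw [letters_rewriteWord, letters_lift]
    exact D.joins_compare _
  have hker : ∀ w w', conGen (fun p q : FreeSemigroup (σ × A) => (p, q) ∈ D.rules) w w' ↔
      val w = val w' := by
    intro w w'
    constructor
    · intro h
      replace h : ConGen.Rel (fun p q : FreeSemigroup (σ × A) => (p, q) ∈ D.rules) w w' := h
      induction h with
      | of p q h => exact hrules _ h
      | refl p => rfl
      | symm _ ih => exact ih.symm
      | trans _ _ ih ih' => exact ih.trans ih'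
      | mul _ _ ih ih' => rw [map_mul, map_mul, ih, ih']
    · intro h
      obtain ⟨l, hl⟩ := exists_walk (hspell w w' h)
      have hl' := D.joins_map_edge (i := D.base) hl (by
        rw [letters_lift, run_spell]; exact D.alive_base)
      rw [← letters_rewriteWord, ← letters_rewriteWord] at hl'
      exact Con.trans _ (hcompare w) (Con.trans _ (con_of_walk hl') (Con.symm _ (hcompare w')))
  let f : (conGen fun p q : FreeSemigroup (σ × A) => (p, q) ∈ D.rules).Quotient →ₙ* G :=
    { toFun := fun x => Con.liftOn x val fun w w' h => (hker w w').1 h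
      map_mul' := fun x y => Con.induction_on₂ x y fun w w' => map_mul val w w' }
  refine ⟨MulEquiv.ofBijective f ⟨fun x y => ?_, fun g => ?_⟩⟩
  · exact Con.induction_on₂ x y fun w w' h => (Con.eq _).2 ((hker w w').2 h)
  · obtain ⟨w, rfl⟩ := hval g
    exact ⟨(w : Con.Quotient _), rfl⟩

end Rewriting
end Rewriting

/-! ### The action on the right cosets of a subgroup -/

section Cosets

variable {S : Type u} [Semigroup S] {G : Subsemigroup S}

theorem image_translate (s t : S) :
    (fun x => x * t) '' translate G s = translate G (s * t) := by
  simp only [translate, Set.image_image, mul_assoc]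

theorem empty_notMem_rightCosets (hG : IsSubgroup G) : ∅ ∉ rightCosets G := by
  obtain ⟨e, he, -⟩ := hG
  rintro ⟨s, -, h, -⟩
  exact (h ▸ Set.mem_image_of_mem _ he : e * s ∈ (∅ : Set S))

theorem mem_rightCosets_of_mul {s t : S} (h : translate G (s * t) ∈ rightCosets G) :
    translate G s ∈ rightCosets G := by
  obtain ⟨x, y, hx, hy⟩ := h
  refine ⟨s, t * y, rfl, ?_⟩
  rw [← mul_assoc, ← image_translate, hx, image_translate, hy]

theorem translate_self (hG : IsSubgroup G) {g : S} (hg : g ∈ G) : translate G g = G := by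
  obtain ⟨e, he, hone, hinv⟩ := hG
  ext x
  constructor
  · rintro ⟨y, hy, rfl⟩
    exact G.mul_mem hy hg
  · intro hx
    obtain ⟨h, hh, -, hhg⟩ := hinv g hg
    refine ⟨x * h, G.mul_mem hx hh, ?_⟩
    change x * h * g = x
    rw [mul_assoc, hhg, (hone x hx).2]

theorem coe_mem_rightCosets (hG : IsSubgroup G) : (G : Set S) ∈ rightCosets G := by
  obtain ⟨e, he, -⟩ := id hG
  exact ⟨e, e, (translate_self hG he).symm, translate_self hG (G.mul_mem he he)⟩

open Classical in
/-- The partial action of `S` on the right cosets of `G`, made total by sending `X` to `∅` if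
`X s` is not a right coset. -/
noncomputable def cosetAct (G : Subsemigroup S) (X : Set S) (s : S) : Set S :=
  if (fun x => x * s) '' X ∈ rightCosets G then (fun x => x * s) '' X else ∅

theorem cosetAct_mem (X : Set S) (s : S) : cosetAct G X s ∈ insert ∅ (rightCosets G) := by
  unfold cosetAct
  split_ifs with h
  · exact Or.inr h
  · exact Or.inl rfl

@[simp] theorem cosetAct_empty (s : S) : cosetAct G ∅ s = ∅ := by
  simp [cosetAct]

open Classical in
theorem cosetAct_translate (x s : S) : cosetAct G (translate G x) s =
    if translate G (x * s) ∈ rightCosets G then translate G (x * s) else ∅ := by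
  rw [cosetAct, image_translate]

theorem cosetAct_eq_image (hG : IsSubgroup G) {X : Set S} {s : S}
    (h : cosetAct G X s ∈ rightCosets G) : cosetAct G X s = (fun x => x * s) '' X := by
  unfold cosetAct at h ⊢
  split_ifs at h ⊢
  · rfl
  · exact absurd h (empty_notMem_rightCosets hG)

theorem cosetAct_cosetAct {X : Set S} (hX : X ∈ insert ∅ (rightCosets G)) (s t : S) :
    cosetAct G (cosetAct G X s) t = cosetAct G X (s * t) := by
  obtain rfl | ⟨x, y, rfl, -⟩ := hX
  · simp
  by_cases h : translate G (x * s) ∈ rightCosets G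
  · rw [cosetAct_translate, if_pos h, cosetAct_translate, cosetAct_translate, mul_assoc]
  · have h' : translate G (x * (s * t)) ∉ rightCosets G := fun h' =>
      h (mem_rightCosets_of_mul (t := t) (by rwa [mul_assoc]))
    simp [cosetAct_translate, h, h']

theorem cosetAct_coe (hG : IsSubgroup G) {g : S} (hg : g ∈ G) : cosetAct G G g = G := by
  have : (fun x => x * g) '' (G : Set S) = G := translate_self hG hg
  rw [cosetAct, this, if_pos (coe_mem_rightCosets hG)]

/-- Right cosets `X` have representatives `r` with right inverses `r'` relative to the identity `e`
of `G`; for `X = G` both can be taken to be `e`. -/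
theorem exists_representatives {e : S} (he : e ∈ G) (hone : ∀ g ∈ G, e * g = g ∧ g * e = g)
    (hinv : ∀ g ∈ G, ∃ h ∈ G, g * h = e ∧ h * g = e)
    (X : Set S) (hX : X ∈ rightCosets G) :
    ∃ r r' : S, r ∈ X ∧ (∀ x ∈ X, x * r' ∈ G ∧ x * r' * r = x) ∧
      (X = G → r = e ∧ r' = e) := by
  by_cases hXG : X = G
  · subst hXG
    refine ⟨e, e, he, fun x hx => ?_, fun _ => ⟨rfl, rfl⟩⟩
    rw [(hone x hx).2]
    exact ⟨hx, (hone x hx).2⟩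
  · obtain ⟨s, s', rfl, hs⟩ := hX
    obtain ⟨g, hg, hgs⟩ : e ∈ translate G (s * s') := by rw [hs]; exact he
    change g * (s * s') = e at hgs
    rw [← mul_assoc] at hgs
    refine ⟨g * s, s', ⟨g, hg, rfl⟩, ?_, fun h => absurd h hXG⟩
    rintro _ ⟨h, hh, rfl⟩
    have key : h * s * s' ∈ G := by
      have : h * (s * s') ∈ translate G (s * s') := ⟨h, hh, rfl⟩
      rw [hs] at this
      rwa [mul_assoc]
    refine ⟨key, ?_⟩
    -- The element `k = e s s'` is the inverse of `g` in `G`.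
    have hk : e * s * s' ∈ G := by
      have : e * (s * s') ∈ translate G (s * s') := ⟨e, he, rfl⟩
      rw [hs] at this
      rwa [mul_assoc]
    obtain ⟨k, hkG, hgk, hkg⟩ := hinv g hg
    have hek : e * s * s' = k := by
      calc e * s * s' = e * (e * s * s') := ((hone _ hk).1).symm
        _ = k * (g * e * s * s') := by rw [← hkg]; simp only [mul_assoc]
        _ = k := by rw [(hone g hg).2, hgs, (hone k hkG).2]
    calc h * s * s' * (g * s) = h * (e * s * s') * g * s := by
          simp only [← mul_assoc, (hone h hh).2]
      _ = h * (k * g) * s := by rw [hek, mul_assoc h]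
      _ = h * s := by rw [hkg, (hone h hh).2]

end Cosets
end FDT

open FDT in
theorem theorem1p1 {S : Type u} [Semigroup S] (G : Subsemigroup S) (hG : FDT.IsSubgroup G)
    (hS : FDT.HasFiniteDerivationType S) (hindex : FDT.HasFiniteTranslationalIndex G) :
    FDT.HasFiniteDerivationType G := by
  obtain ⟨A, hA, hAne, R, hR, ⟨f⟩, C, hCfin, hC⟩ := hS
  obtain ⟨e, he, hone, hinv⟩ := id hG
  -- The evaluation of words over `A` in `S`.
  let π : FreeSemigroup A →ₙ* S :=
    { toFun := fun w => f (w : Con.Quotient _)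
      map_mul' := fun v w => map_mul f (v : Con.Quotient _) (w : Con.Quotient _) }
  have hπ : ∀ v w, π v = π w ↔ conGen (fun p q : FreeSemigroup A => (p, q) ∈ R) v w := fun v w =>
    f.injective.eq_iff.trans (Con.eq _)
  have hπsurj : Function.Surjective π := fun s => by
    obtain ⟨w, hw⟩ := Quotient.mk_surjective (f.symm s)
    exact ⟨w, (congrArg f hw).trans (f.apply_symm_apply s)⟩
  -- The states are the right cosets and `∅`, numbered because the alphabet has to be in `Type`.
  have : Finite ↥(insert ∅ (rightCosets G)) := (Set.Finite.insert ∅ hindex).to_subtype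
  obtain ⟨n, ⟨num⟩⟩ := Finite.exists_equiv_fin ↥(insert ∅ (rightCosets G))
  let coset : Fin n → Set S := fun i => (num.symm i).1
  have hcoset : ∀ i, coset i ∈ insert ∅ (rightCosets G) := fun i => (num.symm i).2
  have hinj : Function.Injective coset := Subtype.val_injective.comp num.symm.injective
  let step : Fin n → A → Fin n := fun i a =>
    num ⟨cosetAct G (coset i) (π (.of a)), cosetAct_mem _ _⟩
  have hstep : ∀ i a, coset (step i a) = cosetAct G (coset i) (π (.of a)) := fun i a => by
    simp [coset, step]
  have hfoldl : ∀ (w : FreeSemigroup A) (i : Fin n),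
      coset ((letters w).foldl step i) = cosetAct G (coset i) (π w) := by
    intro w
    induction w using FreeSemigroup.recOnMul with
    | ih1 a => exact fun i => hstep i a
    | ih2 a w h1 h2 =>
      intro i
      rw [letters_mul, List.foldl_append, h2, h1, map_mul, cosetAct_cosetAct (hcoset i)]
  have hmem_of_act : ∀ i s, cosetAct G (coset i) s ∈ rightCosets G → coset i ∈ rightCosets G := by
    intro i s h
    obtain h' | h' := hcoset i
    · rw [h', cosetAct_empty] at h
      exact absurd h (empty_notMem_rightCosets hG)
    · exact h'
  let base : Fin n := num ⟨G, Or.inr (coe_mem_rightCosets hG)⟩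
  have hbase : coset base = G := by simp [coset, base]
  have : Nonempty S := ⟨e⟩
  choose! rep rep' hrep hrep' hrepG using exists_representatives he hone hinv
  -- The generators `r_i a r'_{ia}` of `G`; the value for dead states is irrelevant.
  have hgen : ∀ i s, cosetAct G (coset i) s ∈ rightCosets G →
      rep (coset i) * s ∈ cosetAct G (coset i) s := by
    intro i s h
    rw [cosetAct_eq_image hG h]
    exact ⟨_, hrep _ (hmem_of_act i s h), rfl⟩
  have hgenG : ∀ i s, cosetAct G (coset i) s ∈ rightCosets G →
      rep (coset i) * s * rep' (cosetAct G (coset i) s) ∈ G :=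
    fun i s h => (hrep' _ h _ (hgen i s h)).1
  classical
  let gen : Fin n × A → G := fun b =>
    if h : cosetAct G (coset b.1) (π (.of b.2)) ∈ rightCosets G then ⟨_, hgenG _ _ h⟩ else ⟨e, he⟩
  choose word hword using fun b => hπsurj (gen b : S)
  let D : Rewriting R (Fin n) :=
    { step := step
      alive := fun i => coset i ∈ rightCosets G
      base := base
      word := word
      alive_of_step := fun i a h => hmem_of_act i _ (by rwa [hstep] at h)
      foldl_rule := fun i p hp => hinj (by
        rw [hfoldl, hfoldl, (hπ p.1 p.2).2 (ConGen.Rel.of _ _ hp)])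
      alive_base := by rw [hbase]; exact coe_mem_rightCosets hG
      foldl_word := fun b => hinj (by
        rw [hfoldl, hword, hbase, cosetAct_coe hG (gen b).2]) }
  let val : FreeSemigroup (Fin n × A) →ₙ* G := FreeSemigroup.lift gen
  have hval_of : ∀ b, val (.of b) = gen b := fun b => FreeSemigroup.lift_of _ _
  -- The value of the rewriting of `w` from the state `i` is `r_i w r'_{iw}`.
  have hval : ∀ (w : FreeSemigroup A) (i : Fin n), cosetAct G (coset i) (π w) ∈ rightCosets G →
      (val (D.rewriteWord i w) : S) =
        rep (coset i) * π w * rep' (cosetAct G (coset i) (π w)) := by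
    intro w
    induction w using FreeSemigroup.recOnMul with
    | ih1 a =>
      intro i h
      change (val (.of (i, a)) : S) = _
      rw [hval_of]
      simp only [gen, dif_pos h]
    | ih2 a w h1 h2 =>
      intro i h
      rw [map_mul, ← cosetAct_cosetAct (hcoset i), ← hstep] at h ⊢
      have hi := hmem_of_act _ _ h
      rw [hstep] at hi
      have e1 : D.rewriteWord i (.of a * w) = D.rewriteWord i (.of a) * D.rewriteWord (step i a) w :=
        letters_injective rfl
      rw [e1, map_mul, MulMemClass.coe_mul, h2 _ h, h1 i hi]
      have key := (hrep' _ hi _ (hgen i _ hi)).2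
      rw [hstep] at h ⊢
      simp only [← mul_assoc, key]
  have hval_base : ∀ (w : FreeSemigroup A) (g : G), π w = g → val (D.rewriteWord base w) = g := by
    intro w g hw
    obtain ⟨h1, h2⟩ := hrepG G (coe_mem_rightCosets hG) rfl
    have h3 : cosetAct G (coset base) (π w) = G := by rw [hw, hbase, cosetAct_coe hG g.2]
    apply Subtype.ext
    rw [hval w base (by rw [h3]; exact coe_mem_rightCosets hG), h3, hbase, h1, h2, hw,
      (hone _ g.2).1, (hone _ g.2).2]
  have hspell : ∀ w, π (FreeSemigroup.lift word w) = val w := by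
    intro w
    induction w using FreeSemigroup.recOnMul with
    | ih1 b => rw [FreeSemigroup.lift_of, hword, hval_of]
    | ih2 b w h1 h2 => rw [map_mul, map_mul, h1, h2, map_mul, MulMemClass.coe_mul]
  refine D.hasFiniteDerivationType hR hCfin hC val ?_ ?_ ?_ ?_
  · intro g
    obtain ⟨w, hw⟩ := hπsurj g
    exact ⟨_, hval_base w g hw⟩
  · intro i q hq h
    have hq' : π q.1 = π q.2 := (hπ _ _).2 (ConGen.Rel.of _ _ hq)
    have h : cosetAct G (coset i) (π q.1) ∈ rightCosets G := by rw [← hfoldl]; exact h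
    apply Subtype.ext
    rw [hval _ _ h, hval _ _ (hq' ▸ h), hq']
  · intro b
    rw [hval_of]
    exact (hval_base _ _ (hword b)).symm
  · intro w w' h
    exact (hπ _ _).1 (by rw [hspell, hspell, h])
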